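/- Let $k$ be a field and let $G$ be a finite simple graph without cycles (for example, a tree) with vertex set $V_G=\{x_1,\dots,x_n\}$; let $N(x)$ denote the set of neighbours of a vertex $x$ and let $\Delta(G)$ denote the maximal degree of a vertex of $G$. Fix an integer $t\ge 1$, and let $$J_t(G)=\bigcap_{x\in V_G}\ \bigcap_{\substack{\{x_{i_1},\dots,x_{i_t}\}\subseteq N(x)\\ x_{i_1},\dots,x_{i_t}\text{ distinct}}}\langle x,x_{i_1},\dots,x_{i_t}\rangle\ \subseteq\ k[x_1,\dots,x_n]$$ be the partial $t$-cover ideal of $G$ (an empty intersection is the whole ring). For an ideal $I$ of $R=k[x_1,\dots,x_n]$, let $\mathrm{Ass}(I)$ be the set of prime ideals of the form $I:\langle T\rangle$ with $T\in R$, and let $\mathrm{astab}(I)$ be the least integer $s_0\ge 1$ such that $\mathrm{Ass}(I^s)=\mathrm{Ass}(I^{s_0})$ for all $s\ge s_0$. Then $J_t(G)$ has the persistence property, i.e. $\mathrm{Ass}(J_t(G)^s)\subseteq\mathrm{Ass}(J_t(G)^{s+1})$ for all $s\ge 1$. Furthermore, $$\mathrm{astab}(J_t(G))=\begin{cases}1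 & \text{if } t=1,\\ \min\{s\ge 1 \mid s(t-1)\ge \Delta(G)-1\} & \text{if } t>1.\end{cases}$$ -/

import Mathlib

namespace Ideal

section AssociatedPrimes

variable {R : Type*} [CommRing R]

/-- The set `Ass(I)` of associated primes of an ideal `I`. In a Noetherian ring this is the set of
the prime ideals of the form `I : ⟨T⟩` with `T ∈ R`; see `Ideal.mem_ass_iff`. -/
abbrev Ass (I : Ideal R) : Set (Ideal R) :=
  Submodule.associatedPrimes I

theorem mem_ass_iff [IsNoetherianRing R] {I P : Ideal R} :
    P ∈ I.Ass ↔ P.IsPrime ∧ ∃ T : R, I.colon (Ideal.span {T} : Set R) = P := by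
  have h : ∀ T : R, I.colon (Ideal.span {T} : Set R) = I.colon {T} := fun T => by
    ext r
    simp only [Submodule.mem_colon, SetLike.mem_coe, Set.mem_singleton_iff, forall_eq, smul_eq_mul]
    refine ⟨fun H => H T (Ideal.mem_span_singleton_self T), fun H x hx => ?_⟩
    obtain ⟨a, rfl⟩ := Ideal.mem_span_singleton'.1 hx
    rw [mul_left_comm]
    exact I.mul_mem_left a H
  simp only [h, eq_comm (b := P)]
  exact Submodule.isAssociatedPrime_iff

/-- The persistence property: `Ass(I ^ s) ⊆ Ass(I ^ (s + 1))` for all `s ≥ 1`. -/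
def HasPersistenceProperty (I : Ideal R) : Prop :=
  ∀ s : ℕ, 1 ≤ s → (I ^ s).Ass ⊆ (I ^ (s + 1)).Ass

/-- `a` is the index of stability of `I`: the least `s₀ ≥ 1` such that
`Ass(I ^ s) = Ass(I ^ s₀)` for all `s ≥ s₀`. -/
def IsIndexOfStability (I : Ideal R) (a : ℕ) : Prop :=
  IsLeast {s₀ : ℕ | 1 ≤ s₀ ∧ ∀ s : ℕ, s₀ ≤ s → (I ^ s).Ass = (I ^ s₀).Ass} a

end AssociatedPrimes

end Ideal

/-- The partial `t`-cover ideal `J_t(G)` in the polynomial ring over `k` with one variable for each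
vertex of `G`: the intersection of the ideals `⟨x, x₁, …, x_t⟩`, over all vertices `x` and all
`t`-element sets `{x₁, …, x_t}` of neighbours of `x`. -/
noncomputable def SimpleGraph.partialCoverIdeal {V : Type*} (G : SimpleGraph V) (k : Type*)
    [Field k] (t : ℕ) : Ideal (MvPolynomial V k) :=
  ⨅ (x : V) (S : Finset V) (_ : (S : Set V) ⊆ G.neighborSet x ∧ S.card = t),
    Ideal.span (MvPolynomial.X '' insert x (S : Set V))

/-! For a star with centre `x` and leaves `S ⊆ N(x)`, `#S ≥ t`, give `x` the weight `#S + 1 - t`,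
each leaf the weight 1 and other variables the weight 0. Then `J_t` has order at least `#S + 1 - t`,
so `J_t ^ s` has order at least `s * (#S + 1 - t)`. In a forest these conditions characterise `J_t ^
s`, and stars with `#S ≤ s * (t - 1) + 1` suffice (`partialCoverIdeal_pow_eq_inf`). To split a
monomial of exponent `a` into `s` covers is to choose for each `v` the `s - a v` covers omitting
`v`, so that no cover omits a vertex together with `t` of its neighbours. Such a multicolouring is
built leaf by leaf, with minimal overlaps along edges, spread evenly over the colours
(`exists_balanced_multicoloring`).

Weighted order is additive, so each condition contributes at most the prime generated by its star;
an explicit monomial shows that each of these primes occurs. Hence `Ass (J_t ^ s)` consists of the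
star primes with `t ≤ #S ≤ s * (t - 1) + 1` (`mem_ass_partialCoverIdeal_pow_iff`). This set grows
with `s`, and it is stable from the start if `t = 1`, and otherwise once the bound reaches the
maximal degree. -/

open Finset

/-! ### Multicolourings of forests. -/

namespace SimpleGraph

/-- A nonempty finite set of vertices of a forest contains a vertex with at most one neighbour in
the set. -/
theorem IsAcyclic.exists_mem_subsingleton_adj {V : Type*} {G : SimpleGraph V} (hG : G.IsAcyclic)
    {U : Finset V} (hU : U.Nonempty) :
    ∃ l ∈ U, ∀ v ∈ U, ∀ w ∈ U, G.Adj l v → G.Adj l w → v = w := by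
  have hH : (G.induce (U : Set V)).IsAcyclic := hG.induce _
  have : Nonempty (U : Set V) := hU.to_subtype
  -- The end of a longest path is a leaf: a neighbour off the path would lengthen it, and one on the
  -- path other than the penultimate vertex would close a cycle.
  obtain ⟨u, l, p, hp, hmax⟩ :=
    Walk.exists_isPath_forall_isPath_length_le_length (G.induce (U : Set V))
  have key : ∀ v : (U : Set V), (G.induce (U : Set V)).Adj l v → v = p.penultimate := by
    intro v hv
    refine hH.eq_penultimate_of_adj_end hp hv ?_
    by_contra hn
    have := hmax _ _ _ (hp.concat hn hv)
    simp at this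
  refine ⟨l, l.2, fun v hv w hw hlv hlw => ?_⟩
  have h1 := key ⟨v, hv⟩ (by simpa using hlv)
  have h2 := key ⟨w, hw⟩ (by simpa using hlw)
  exact congrArg Subtype.val (h1.trans h2.symm)

end SimpleGraph

/-- If the values of `n` on `B` differ by at most one, then one can add `1` to `m` of them and keep
this property. -/
theorem Finset.exists_subset_card_eq_balanced {α : Type*} [DecidableEq α] (B : Finset α)
    (n : α → ℕ) (hn : ∀ i ∈ B, ∀ j ∈ B, n i ≤ n j + 1) {m : ℕ} (hm : m ≤ #B) :
    ∃ D ⊆ B, #D = m ∧ ∀ i ∈ B, ∀ j ∈ B,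
      n i + (if i ∈ D then 1 else 0) ≤ n j + (if j ∈ D then 1 else 0) + 1 := by
  rcases B.eq_empty_or_nonempty with rfl | hB
  · exact ⟨∅, by simp, by simp_all, by simp⟩
  obtain ⟨b, hb, hmin⟩ := exists_min_image B n hB
  -- The elements of minimal value are raised before any others.
  set L := B.filter fun i => n i = n b with hL
  have hLB : L ⊆ B := filter_subset _ _
  rcases le_total m #L with h | h
  · obtain ⟨D, hDL, hD⟩ := exists_subset_card_eq h
    refine ⟨D, hDL.trans hLB, hD, fun i hi j hj => ?_⟩
    have h1 := hn i hi b hb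
    have h2 := hmin j hj
    have h3 : i ∈ D → n i = n b := fun hi => (mem_filter.1 (hDL hi)).2
    split_ifs with h4 h5 h5 <;> first | omega | (have := h3 h4; omega)
  · obtain ⟨D, hLD, hDB, hD⟩ := exists_subsuperset_card_eq hLB h hm
    refine ⟨D, hDB, hD, fun i hi j hj => ?_⟩
    have h1 := hn i hi b hb
    have h2 := hmin j hj
    have h3 : j ∉ D → n j ≠ n b := fun hj' h => hj' (hLD (mem_filter.2 ⟨hj, h⟩))
    split_ifs with h4 h5 h5 <;> first | omega | (have := h3 h5; omega)

namespace SimpleGraph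

/-- The vertices of a forest can be given subsets of `Fin s` of prescribed sizes, with the
intersection along each edge as small as possible, and such that the elements of the set of a vertex
are shared evenly with its neighbours. -/
theorem IsAcyclic.exists_balanced_multicoloring {V : Type*} [DecidableEq V] {G : SimpleGraph V}
    [DecidableRel G.Adj] (hG : G.IsAcyclic) {s : ℕ} (c : V → ℕ) (hc : ∀ v, c v ≤ s)
    (U : Finset V) :
    ∃ B : V → Finset (Fin s), (∀ v ∈ U, #(B v) = c v) ∧
      (∀ u ∈ U, ∀ v ∈ U, G.Adj u v → #(B u ∩ B v) = c u + c v - s) ∧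
      ∀ x ∈ U, ∀ i ∈ B x, ∀ j ∈ B x,
        #{y ∈ U | G.Adj x y ∧ i ∈ B y} ≤ #{y ∈ U | G.Adj x y ∧ j ∈ B y} + 1 := by
  induction U using Finset.strongInduction with
  | H U ih =>
  rcases U.eq_empty_or_nonempty with rfl | hU
  · exact ⟨fun _ => ∅, by simp, by simp, by simp⟩
  obtain ⟨l, hl, hleaf⟩ := hG.exists_mem_subsingleton_adj hU
  obtain ⟨B, hB1, hB2, hB3⟩ := ih (U.erase l) (erase_ssubset hl)
  -- `C` is the colour set of the leaf `l`. It takes as many colours as possible outside `B p`,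
  -- where `p` is the only neighbour of `l` in `U`; the forced overlap `D` is chosen to keep `p`
  -- balanced.
  obtain ⟨C, hC1, hC2⟩ : ∃ C : Finset (Fin s), #C = c l ∧
      ∀ p ∈ U, G.Adj l p → #(B p ∩ C) = c p + c l - s ∧ ∀ i ∈ B p, ∀ j ∈ B p,
        #{y ∈ U.erase l | G.Adj p y ∧ i ∈ B y} + (if i ∈ C then 1 else 0) ≤
          #{y ∈ U.erase l | G.Adj p y ∧ j ∈ B y} + (if j ∈ C then 1 else 0) + 1 := by
    by_cases hp : ∃ p ∈ U, G.Adj l p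
    · obtain ⟨p, hp, hlp⟩ := hp
      have hp' : p ∈ U.erase l := mem_erase.2 ⟨hlp.ne', hp⟩
      have hcl := hc l
      have hcp := hc p
      have hBp := hB1 p hp'
      obtain ⟨D, hDB, hD, hbal⟩ := (B p).exists_subset_card_eq_balanced
        (fun i => #{y ∈ U.erase l | G.Adj p y ∧ i ∈ B y}) (hB3 p hp')
        (m := c p + c l - s) (by omega)
      obtain ⟨E, hE, hEc⟩ := exists_subset_card_eq (s := (B p)ᶜ)
        (n := c l - (c p + c l - s)) (by rw [card_compl, Fintype.card_fin]; omega)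
      have hdisj : Disjoint (B p) E := Finset.disjoint_left.2 fun i hi hi' => mem_compl.1 (hE hi') hi
      have hmem : ∀ i ∈ B p, (i ∈ D ∪ E ↔ i ∈ D) := fun i hi => by
        have := Finset.disjoint_left.1 hdisj hi
        simp [this]
      refine ⟨D ∪ E, ?_, fun q hq hlq => ?_⟩
      · rw [card_union_of_disjoint (hdisj.mono_left hDB)]
        omega
      · obtain rfl := hleaf p hp q hq hlp hlq
        refine ⟨?_, fun i hi j hj => ?_⟩
        · rw [inter_union_distrib_left, disjoint_iff_inter_eq_empty.1 hdisj, union_empty,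
            inter_eq_right.2 hDB, hD]
        · simpa only [hmem i hi, hmem j hj] using hbal i hi j hj
    · obtain ⟨C, -, hC⟩ := exists_subset_card_eq (s := (univ : Finset (Fin s))) (n := c l)
        (by simpa using hc l)
      exact ⟨C, hC, fun p hpU hlp => absurd ⟨p, hpU, hlp⟩ hp⟩
  have hBne : ∀ v, v ≠ l → Function.update B l C v = B v := fun v hv =>
    Function.update_of_ne hv _ _
  have hcount : ∀ x i, #{y ∈ U | G.Adj x y ∧ i ∈ Function.update B l C y} =
      #{y ∈ U.erase l | G.Adj x y ∧ i ∈ B y} + (if G.Adj x l ∧ i ∈ C then 1 else 0) := by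
    intro x i
    rw [← insert_erase hl, filter_insert, erase_insert (notMem_erase l U)]
    have h1 : {y ∈ U.erase l | G.Adj x y ∧ i ∈ Function.update B l C y} =
        {y ∈ U.erase l | G.Adj x y ∧ i ∈ B y} :=
      filter_congr fun y hy => by rw [hBne y (ne_of_mem_erase hy)]
    rw [h1, Function.update_self]
    split_ifs with h
    · rw [card_insert_of_notMem (by simp)]
    · rfl
  refine ⟨Function.update B l C, fun v hv => ?_, fun u hu v hv huv => ?_, fun x hx i hi j hj => ?_⟩
  · rcases eq_or_ne v l with rfl | h
    · rw [Function.update_self, hC1]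
    · rw [hBne v h, hB1 v (mem_erase.2 ⟨h, hv⟩)]
  · rcases eq_or_ne u l with rfl | h
    · rw [Function.update_self, hBne v huv.ne', inter_comm, (hC2 v hv huv).1, add_comm]
    · rcases eq_or_ne v l with rfl | h'
      · rw [Function.update_self, hBne u h, (hC2 u hu huv.symm).1]
      · rw [hBne v h', hBne u h, hB2 u (mem_erase.2 ⟨h, hu⟩) v (mem_erase.2 ⟨h', hv⟩) huv]
  · rcases eq_or_ne x l with rfl | h
    · refine le_trans (card_le_one.2 fun y hy z hz => ?_) (Nat.le_add_left 1 _)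
      simp only [mem_filter] at hy hz
      exact hleaf y hy.1 z hz.1 hy.2.1 hz.2.1
    · rw [hBne x h] at hi hj
      rw [hcount, hcount]
      by_cases hxl : G.Adj x l
      · simpa [hxl] using (hC2 x hx hxl.symm).2 i hi j hj
      · simpa [hxl] using hB3 x (mem_erase.2 ⟨h, hx⟩) i hi j hj

/-- In a forest, star inequalities guarantee a multicolouring by `Fin s` with prescribed numbers of
colours in which no vertex shares a given colour with `t` neighbours. -/
theorem IsAcyclic.exists_multicoloring {V : Type*} [Fintype V] {G : SimpleGraph V}
    [DecidableRel G.Adj] (hG : G.IsAcyclic) {s t : ℕ} (ht : 1 ≤ t) (c : V → ℕ) (hc : ∀ v, c v ≤ s)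
    (hstar : ∀ x, ∑ y ∈ G.neighborFinset x, (c x + c y - s) ≤ (t - 1) * c x) :
    ∃ B : V → Finset (Fin s), (∀ v, #(B v) = c v) ∧
      ∀ x, ∀ i ∈ B x, #{y ∈ G.neighborFinset x | i ∈ B y} < t := by
  classical
  obtain ⟨B, hB1, hB2, hB3⟩ := hG.exists_balanced_multicoloring c hc univ
  refine ⟨B, fun v => hB1 v (mem_univ v), fun x i hi => ?_⟩
  have hfilter : ∀ x j, ({y ∈ univ | G.Adj x y ∧ j ∈ B y} : Finset V) =
      {y ∈ G.neighborFinset x | j ∈ B y} := fun x j => by ext; simp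
  simp only [hfilter] at hB3
  have hsum : ∑ j ∈ B x, #{y ∈ G.neighborFinset x | j ∈ B y} ≤ (t - 1) * c x := by
    refine le_trans (le_of_eq ?_) (hstar x)
    have := sum_card_bipartiteAbove_eq_sum_card_bipartiteBelow (s := B x)
      (t := G.neighborFinset x) (fun j y => j ∈ B y)
    refine this.trans (sum_congr rfl fun y hy => ?_)
    rw [← hB2 x (mem_univ x) y (mem_univ y) (by simpa using hy)]
    rw [bipartiteBelow, filter_mem_eq_inter]
  by_contra! hlt
  -- If one colour occurs at least `t` times, balance forces every colour of `x` to occur at least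
  -- `t - 1` times, and the total is too large.
  have : ∑ j ∈ B x, (t - 1) < ∑ j ∈ B x, #{y ∈ G.neighborFinset x | j ∈ B y} := by
    refine sum_lt_sum (fun j hj => ?_) ⟨i, hi, by omega⟩
    have := hB3 x (mem_univ x) i hi j hj
    omega
  rw [sum_const, hB1 x (mem_univ x), smul_eq_mul, mul_comm] at this
  omega

end SimpleGraph

/-! ### Associated primes of intersections and of weighted order ideals. -/

theorem Ideal.exists_mem_ass_of_mem_ass_finset_inf {R ι : Type*} [CommRing R] [IsNoetherianRing R]
    {T : Finset ι} {Q : ι → Ideal R} {P : Ideal R} (hP : P ∈ (T.inf Q).Ass) :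
    ∃ i ∈ T, P ∈ (Q i).Ass := by
  obtain ⟨hprime, f, hf⟩ := Submodule.isAssociatedPrime_iff.1 hP
  have hmem : ∀ r, r ∈ P ↔ ∀ i ∈ T, r ∈ (Q i).colon {f} := fun r => by
    simp [hf, Submodule.mem_colon_singleton, Submodule.mem_finsetInf]
  have hle : T.inf (fun i => (Q i).colon {f}) ≤ P := fun r hr =>
    (hmem r).2 fun i hi => (Submodule.mem_finsetInf).1 hr i hi
  obtain ⟨i, hi, hle⟩ := hprime.inf_le'.1 hle
  exact ⟨i, hi, Submodule.isAssociatedPrime_iff.2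
    ⟨hprime, f, le_antisymm (fun r hr => (hmem r).1 hr i hi) hle⟩⟩

namespace MvPolynomial

variable {σ R : Type*} [CommRing R] (w : σ → ℕ)

theorem natCast_le_weightedOrder_coe_iff {n : ℕ} {p : MvPolynomial σ R} :
    (n : ℕ∞) ≤ (p : MvPowerSeries σ R).weightedOrder w ↔
      ∀ a ∈ p.support, n ≤ Finsupp.weight w a := by
  refine ⟨fun h a ha => ?_, fun h => MvPowerSeries.nat_le_weightedOrder w fun d hd => ?_⟩
  · rw [mem_support_iff, ← coeff_coe] at ha
    exact_mod_cast h.trans (MvPowerSeries.weightedOrder_le w ha)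
  · by_contra hne
    rw [coeff_coe] at hne
    exact absurd (h d (mem_support_iff.2 hne)) (by omega)

theorem mem_span_X_image_iff_one_le_weightedOrder {p : MvPolynomial σ R} :
    p ∈ Ideal.span (X '' {i | w i ≠ 0} : Set (MvPolynomial σ R)) ↔
      1 ≤ (p : MvPowerSeries σ R).weightedOrder w := by
  rw [mem_ideal_span_X_image, ← Nat.cast_one, natCast_le_weightedOrder_coe_iff]
  refine forall₂_congr fun a _ => ?_
  rw [Nat.one_le_iff_ne_zero, Finsupp.weight_apply, Finsupp.sum, Ne, sum_eq_zero_iff]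
  simp only [Set.mem_ofPred_eq, smul_eq_mul, mul_eq_zero, Finsupp.mem_support_iff, not_forall]
  exact ⟨fun ⟨i, h1, h2⟩ => ⟨i, h2, by tauto⟩, fun ⟨i, h1, h2⟩ => ⟨i, by tauto, h1⟩⟩

/-- The ideal of the polynomials of weighted order at least `n`. -/
def weightedOrderIdeal (n : ℕ) : Ideal (MvPolynomial σ R) where
  carrier := {p | (n : ℕ∞) ≤ (p : MvPowerSeries σ R).weightedOrder w}
  zero_mem' := by simp
  add_mem' {p q} hp hq := by
    simp only [Set.mem_ofPred_eq, coe_add] at *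
    exact (le_min hp hq).trans (MvPowerSeries.min_weightedOrder_le_add w)
  smul_mem' p q hq := by
    simp only [Set.mem_ofPred_eq, smul_eq_mul, coe_mul] at *
    exact hq.trans (le_add_self.trans (MvPowerSeries.le_weightedOrder_mul w))

variable {w}

theorem mem_weightedOrderIdeal {n : ℕ} {p : MvPolynomial σ R} :
    p ∈ weightedOrderIdeal w n ↔ (n : ℕ∞) ≤ (p : MvPowerSeries σ R).weightedOrder w :=
  Iff.rfl

theorem mem_weightedOrderIdeal_iff_support {n : ℕ} {p : MvPolynomial σ R} :
    p ∈ weightedOrderIdeal w n ↔ ∀ a ∈ p.support, n ≤ Finsupp.weight w a :=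
  natCast_le_weightedOrder_coe_iff w

theorem weightedOrderIdeal_pow_le (m n : ℕ) :
    (weightedOrderIdeal w m : Ideal (MvPolynomial σ R)) ^ n ≤ weightedOrderIdeal w (n * m) := by
  induction n with
  | zero => exact fun p _ => by simp [mem_weightedOrderIdeal]
  | succ n ih =>
    rw [pow_succ]
    refine Ideal.mul_le.2 fun p hp q hq => ?_
    have hp := ih hp
    rw [mem_weightedOrderIdeal] at hp hq ⊢
    rw [coe_mul, Nat.succ_mul, Nat.cast_add]
    exact (add_le_add hp hq).trans (MvPowerSeries.le_weightedOrder_mul w)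

variable [IsDomain R]

theorem isPrime_span_X_image (s : Set σ) :
    (Ideal.span (X '' s : Set (MvPolynomial σ R))).IsPrime := by
  classical
  obtain ⟨w, rfl⟩ : ∃ w : σ → ℕ, s = {i | w i ≠ 0} := ⟨s.indicator 1, by ext; simp⟩
  refine ⟨fun h => ?_, fun {p q} h => ?_⟩
  · have := (Ideal.eq_top_iff_one _).1 h
    rw [mem_span_X_image_iff_one_le_weightedOrder, coe_one,
      MvPowerSeries.weightedOrder_one] at this
    simp at this
  · simp only [mem_span_X_image_iff_one_le_weightedOrder, coe_mul,
      MvPowerSeries.weightedOrder_mul, Order.one_le_iff_ne_zero] at *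
    by_contra! hc
    exact h (by simp [hc])

/-- Orders add over a domain, so a factor of order 0 cannot bring `f` into the ideal, while the
`n`-th power of an element of positive order already lies in it. -/
theorem eq_span_X_image_of_mem_ass_weightedOrderIdeal [IsNoetherianRing (MvPolynomial σ R)] {n : ℕ}
    {P : Ideal (MvPolynomial σ R)}
    (hP : P ∈ (weightedOrderIdeal w n : Ideal (MvPolynomial σ R)).Ass) :
    P = Ideal.span (X '' {i | w i ≠ 0}) := by
  obtain ⟨hprime, f, hf⟩ := Submodule.isAssociatedPrime_iff.1 hP
  have hmem : ∀ g, g ∈ P ↔ g * f ∈ weightedOrderIdeal w n := fun g => by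
    rw [hf, Submodule.mem_colon_singleton, smul_eq_mul]
  refine le_antisymm (fun g hg => ?_) (fun g hg => ?_)
  · rw [mem_span_X_image_iff_one_le_weightedOrder, Order.one_le_iff_ne_zero]
    intro h0
    refine hprime.ne_top ((Ideal.eq_top_iff_one _).2 ((hmem 1).2 ?_))
    have := (hmem g).1 hg
    rw [mem_weightedOrderIdeal, coe_mul, MvPowerSeries.weightedOrder_mul, h0, zero_add] at this
    rwa [one_mul]
  · refine hprime.mem_of_pow_mem n ((hmem _).2 (Ideal.mul_mem_right _ _ ?_))
    have h1 : g ∈ weightedOrderIdeal w 1 :=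
      (mem_span_X_image_iff_one_le_weightedOrder w).1 hg
    simpa using weightedOrderIdeal_pow_le 1 n (Ideal.pow_mem_pow h1 n)

end MvPolynomial

theorem Finset.exists_sum_eq_of_le_card_mul {α : Type*} (S : Finset α) (b : ℕ) {m : ℕ}
    (hm : m ≤ #S * b) : ∃ d : α → ℕ, (∀ y, d y ≤ b) ∧ ∑ y ∈ S, d y = m := by
  classical
  induction S using Finset.induction_on generalizing m with
  | empty => exact ⟨0, by simp, by simp_all⟩
  | insert x S hx ih =>
    rw [card_insert_of_notMem hx, Nat.succ_mul] at hm
    obtain ⟨d, hd, hsum⟩ := ih (m := m - min m b) (by omega)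
    refine ⟨Function.update d x (min m b), fun y => ?_, ?_⟩
    · rcases eq_or_ne y x with rfl | h
      · simp
      · rw [Function.update_of_ne h]
        exact hd y
    · rw [sum_insert hx, sum_update_of_notMem hx, Function.update_self, hsum]
      omega

/-! ### Powers of the cover ideal as intersections over stars. -/

namespace SimpleGraph

variable {V : Type*}

/-- The weight of the variables for which the partial `t`-cover ideal of the star with centre `x`
and set of leaves `S` has order `#S + 1 - t`. -/
def starWeight [DecidableEq V] (t : ℕ) (x : V) (S : Finset V) : V → ℕ :=
  fun v => if v = x then #S + 1 - t else if v ∈ S then 1 else 0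

theorem weight_starWeight [DecidableEq V] {t : ℕ} {x : V} {S : Finset V} (hx : x ∉ S)
    (a : V →₀ ℕ) :
    Finsupp.weight (starWeight t x S) a = (#S + 1 - t) * a x + ∑ y ∈ S, a y := by
  have hsub : a.support ⊆ insert x (S ∪ a.support) := by
    intro y hy
    simp [Finsupp.mem_support_iff.1 hy]
  have hsub' : insert x S ⊆ insert x (S ∪ a.support) := insert_subset_insert _ subset_union_left
  rw [Finsupp.weight_apply, Finsupp.sum_of_support_subset a hsub _ (by simp),
    ← sum_subset hsub', sum_insert hx]
  · congr 1
    · simp [starWeight, mul_comm]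
    · refine sum_congr rfl fun y hy => ?_
      simp [starWeight, ne_of_mem_of_not_mem hy hx, hy]
  · intro y _ hy
    rw [mem_insert, not_or] at hy
    simp [starWeight, hy.1, hy.2]

theorem setOf_starWeight_ne_zero [DecidableEq V] {t : ℕ} {x : V} {S : Finset V} (hS : t ≤ #S) :
    {v | starWeight t x S v ≠ 0} = insert x (S : Set V) := by
  ext v
  simp only [starWeight, Set.mem_ofPred_eq, Set.mem_insert_iff, mem_coe]
  split_ifs with h1 h2 <;> simp [h1]
  · omega
  · assumption
  · assumption

variable {G : SimpleGraph V} {k : Type*} [Field k] {t s : ℕ}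

theorem mem_partialCoverIdeal {p : MvPolynomial V k} :
    p ∈ G.partialCoverIdeal k t ↔ ∀ (x : V) (S : Finset V), (S : Set V) ⊆ G.neighborSet x →
      #S = t → ∀ a ∈ p.support, ∃ v ∈ insert x (S : Set V), a v ≠ 0 := by
  simp only [partialCoverIdeal, Submodule.mem_iInf, MvPolynomial.mem_ideal_span_X_image, and_imp]

theorem notMem_of_coe_subset_neighborSet {x : V} {S : Finset V}
    (hS : (S : Set V) ⊆ G.neighborSet x) : x ∉ S :=
  fun h => G.irrefl (hS h)

/-- A monomial of the ideal that avoids `x` misses fewer than `t` of the leaves; one divisible by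
`x` has enough weight from `x` alone. -/
theorem partialCoverIdeal_le_weightedOrderIdeal [DecidableEq V] {x : V} {S : Finset V}
    (hS : (S : Set V) ⊆ G.neighborSet x) :
    G.partialCoverIdeal k t ≤
      MvPolynomial.weightedOrderIdeal (starWeight t x S) (#S + 1 - t) := by
  intro p hp
  rw [MvPolynomial.mem_weightedOrderIdeal_iff_support]
  intro a ha
  rw [weight_starWeight (notMem_of_coe_subset_neighborSet hS)]
  rcases Nat.eq_zero_or_pos (a x) with h0 | h0
  · set Z := S.filter fun y => a y = 0 with hZ
    have hZt : #Z < t := by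
      by_contra! hle
      obtain ⟨Y, hY, hYc⟩ := exists_subset_card_eq hle
      obtain ⟨v, hv, hav⟩ := mem_partialCoverIdeal.1 hp x Y
        (fun y hy => hS (filter_subset _ _ (hY hy))) hYc a ha
      rcases hv with rfl | hv
      · exact hav h0
      · exact hav (mem_filter.1 (hY hv)).2
    have h1 : #S ≤ #Z + ∑ y ∈ S, a y := by
      rw [hZ, card_filter, ← sum_add_distrib, card_eq_sum_ones]
      refine sum_le_sum fun y _ => ?_
      split_ifs <;> omega
    rw [h0]
    omega
  · exact (Nat.le_mul_of_pos_right _ h0).trans (Nat.le_add_right _ _)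

theorem partialCoverIdeal_pow_le_weightedOrderIdeal [DecidableEq V] {x : V} {S : Finset V}
    (hS : (S : Set V) ⊆ G.neighborSet x) :
    G.partialCoverIdeal k t ^ s ≤
      MvPolynomial.weightedOrderIdeal (starWeight t x S) (s * (#S + 1 - t)) :=
  (Ideal.pow_right_mono (partialCoverIdeal_le_weightedOrderIdeal hS) s).trans
    (MvPolynomial.weightedOrderIdeal_pow_le _ _)

variable [Fintype V] [DecidableRel G.Adj]

/-- Colour `i` in `B v` means that the `i`-th of `s` squarefree covers omits `v`; the product of
these covers divides the monomial. -/
theorem IsAcyclic.monomial_mem_partialCoverIdeal_pow (hG : G.IsAcyclic) (ht : 1 ≤ t) {a : V →₀ ℕ}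
    (ha : ∀ x, ∑ y ∈ G.neighborFinset x, (s - a x + (s - a y) - s) ≤ (t - 1) * (s - a x)) (r : k) :
    MvPolynomial.monomial a r ∈ G.partialCoverIdeal k t ^ s := by
  classical
  obtain ⟨B, hB, hBt⟩ := hG.exists_multicoloring ht (fun v => s - a v) (fun v => Nat.sub_le _ _) ha
  have hcover : ∀ i : Fin s,
      MvPolynomial.monomial (Finsupp.equivFunOnFinite.symm fun v => if i ∈ B v then 0 else 1)
        (1 : k) ∈ G.partialCoverIdeal k t := by
    intro i
    rw [mem_partialCoverIdeal]
    intro x S hS hSc b hb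
    obtain rfl := mem_singleton.1 (MvPolynomial.support_monomial_subset hb)
    by_contra! h
    have h' : ∀ v ∈ insert x (S : Set V), i ∈ B v := fun v hv => by simpa using h v hv
    refine (hBt x i (h' x (Set.mem_insert _ _))).not_ge (hSc ▸ card_le_card fun y hy => ?_)
    exact mem_filter.2 ⟨by simpa using hS hy, h' y (Set.mem_insert_of_mem _ hy)⟩
  have hprod := Ideal.prod_mem_prod (s := (univ : Finset (Fin s))) fun i _ => hcover i
  rw [prod_const, card_univ, Fintype.card_fin, ← MvPolynomial.monomial_sum_one] at hprod
  set e : V →₀ ℕ := ∑ i : Fin s, Finsupp.equivFunOnFinite.symm fun v => if i ∈ B v then 0 else 1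
  have he : e ≤ a := by
    intro v
    have h1 : e v = #(B v)ᶜ := by
      simp only [e, Finsupp.finsetSum_apply, Finsupp.equivFunOnFinite_symm_apply_apply]
      rw [compl_eq_univ_sdiff, sdiff_eq_filter, card_filter]
      exact sum_congr rfl fun i _ => by split_ifs <;> simp_all
    rw [h1, card_compl, Fintype.card_fin, hB]
    omega
  have := Ideal.mul_mem_left _ (MvPolynomial.monomial (a - e) r) hprod
  rwa [MvPolynomial.monomial_mul, tsub_add_cancel_of_le he, mul_one] at this

/-- On a set `S` of leaves with positive terms the truncations disappear, and the star inequality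
becomes the weight condition of `S`. Positive terms are at least 1, so `(t - 1) * (s - a x) + 1` of
them already violate the inequality; this bounds `#S`. -/
theorem sum_sub_le_of_forall_subset (ht : 1 ≤ t) {a : V → ℕ} {x : V}
    (h : ∀ S : Finset V, (S : Set V) ⊆ G.neighborSet x → t ≤ #S → #S ≤ s * (t - 1) + 1 →
      s * (#S + 1 - t) ≤ (#S + 1 - t) * a x + ∑ y ∈ S, a y) :
    ∑ y ∈ G.neighborFinset x, (s - a x + (s - a y) - s) ≤ (t - 1) * (s - a x) := by
  classical
  by_contra! hlt
  obtain ⟨S, hSN, hSpos, hScard, hSsum⟩ : ∃ S ⊆ G.neighborFinset x,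
      (∀ y ∈ S, 0 < s - a x + (s - a y) - s) ∧ #S ≤ (t - 1) * (s - a x) + 1 ∧
      (t - 1) * (s - a x) < ∑ y ∈ S, (s - a x + (s - a y) - s) := by
    set S := {y ∈ G.neighborFinset x | 0 < s - a x + (s - a y) - s} with hS
    rcases le_total #S ((t - 1) * (s - a x) + 1) with hle | hle
    · refine ⟨S, filter_subset _ _, fun y hy => (mem_filter.1 hy).2, hle, hlt.trans_eq ?_⟩
      refine (sum_subset (filter_subset _ _) fun y hy hyS => ?_).symm
      by_contra h0
      exact hyS (mem_filter.2 ⟨hy, Nat.pos_of_ne_zero h0⟩)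
    · obtain ⟨Y, hY, hYc⟩ := exists_subset_card_eq hle
      have hpos : ∀ y ∈ Y, 0 < s - a x + (s - a y) - s := fun y hy => (mem_filter.1 (hY hy)).2
      refine ⟨Y, hY.trans (filter_subset _ _), hpos, hYc.le, ?_⟩
      have := card_nsmul_le_sum Y _ 1 hpos
      rw [smul_eq_mul, mul_one, hYc] at this
      omega
  obtain ⟨y₀, hy₀⟩ : S.Nonempty := by
    rw [nonempty_iff_ne_empty]
    rintro rfl
    simp at hSsum
  have hax : a x ≤ s := by
    have := hSpos y₀ hy₀
    omega
  have hS1 : ∑ y ∈ S, (s - a x + (s - a y) - s) + ∑ y ∈ S, a y = #S * (s - a x) := by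
    rw [← sum_add_distrib, ← smul_eq_mul, ← sum_const]
    refine sum_congr rfl fun y hy => ?_
    have := hSpos y hy
    omega
  have hSt : t ≤ #S := by
    by_contra! hc
    have : #S * (s - a x) ≤ (t - 1) * (s - a x) := Nat.mul_le_mul_right _ (by omega)
    omega
  have hScard' : #S ≤ s * (t - 1) + 1 := by
    have : (t - 1) * (s - a x) ≤ (t - 1) * s := Nat.mul_le_mul_left _ (Nat.sub_le _ _)
    rw [mul_comm s]
    omega
  have key := h S (fun y hy => by simpa using hSN hy) hSt hScard'
  obtain ⟨r, hr⟩ : ∃ r, #S = r + (t - 1) := ⟨#S - (t - 1), by omega⟩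
  obtain ⟨c, hc⟩ : ∃ c, s = a x + c := ⟨s - a x, by omega⟩
  have h1 : #S + 1 - t = r := by omega
  have h2 : s - a x = c := by omega
  rw [h1] at key
  rw [h2] at hSsum hS1
  rw [hr] at hS1
  have : s * r = r * a x + r * c := by rw [hc]; ring
  have : (r + (t - 1)) * c = r * c + (t - 1) * c := by ring
  omega

theorem IsAcyclic.partialCoverIdeal_pow_eq_inf [DecidableEq V] (hG : G.IsAcyclic) (ht : 1 ≤ t) :
    G.partialCoverIdeal k t ^ s =
      ({p : V × Finset V | p.2 ⊆ G.neighborFinset p.1 ∧ t ≤ #p.2 ∧ #p.2 ≤ s * (t - 1) + 1} :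
        Finset (V × Finset V)).inf fun p =>
          MvPolynomial.weightedOrderIdeal (starWeight t p.1 p.2) (s * (#p.2 + 1 - t)) := by
  refine le_antisymm (Finset.le_inf fun p hp => ?_) fun f hf => ?_
  · refine partialCoverIdeal_pow_le_weightedOrderIdeal fun y hy => ?_
    simpa using (mem_filter.1 hp).2.1 hy
  · rw [f.as_sum]
    refine sum_mem fun a ha => hG.monomial_mem_partialCoverIdeal_pow ht (fun x => ?_) _
    refine sum_sub_le_of_forall_subset ht fun S hS hSt hSs => ?_
    have := Submodule.mem_finsetInf.1 hf (x, S) (mem_filter.2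
      ⟨mem_univ _, fun y hy => by simpa using hS hy, hSt, hSs⟩)
    rw [MvPolynomial.mem_weightedOrderIdeal_iff_support] at this
    have := this a ha
    rwa [weight_starWeight (notMem_of_coe_subset_neighborSet hS)] at this

end SimpleGraph

/-! ### The associated primes of the powers, and their stability. -/

namespace SimpleGraph

variable {V : Type*} {G : SimpleGraph V} {k : Type*} [Field k] {t s : ℕ}
variable [Fintype V] [DecidableRel G.Adj]

/-- The star inequalities for an exponent which is at least `s` outside of the star with centre `x`
and set of leaves `S`. -/
theorem IsAcyclic.sum_sub_le_of_forall_notMem (hG : G.IsAcyclic) {a : V → ℕ} {x : V}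
    {S : Finset V} (hS : (S : Set V) ⊆ G.neighborSet x) (hout : ∀ v, v ≠ x → v ∉ S → s ≤ a v)
    (hcenter : ∑ y ∈ S, (s - a x + (s - a y) - s) ≤ (t - 1) * (s - a x))
    (hleaf : ∀ z ∈ S, s - a z + (s - a x) - s ≤ (t - 1) * (s - a z)) (z : V) :
    ∑ y ∈ G.neighborFinset z, (s - a z + (s - a y) - s) ≤ (t - 1) * (s - a z) := by
  classical
  rcases eq_or_ne z x with rfl | hzx
  · rwa [← sum_subset (s₁ := S) (fun y hy => by simpa using hS hy)]
    intro y hy hyS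
    have := hout y (G.ne_of_adj (by simpa using hy)).symm hyS
    omega
  by_cases hzS : z ∈ S
  · have hxz : G.Adj x z := hS hzS
    rw [sum_eq_single_of_mem x (by simpa using hxz.symm)]
    · exact hleaf z hzS
    · intro y hy hyx
      have hzy : G.Adj z y := by simpa using hy
      have hyS : y ∉ S := fun hyS =>
        -- A forest has no triangles, so two leaves of a star are not adjacent.
        hG.cliqueFree le_rfl {x, z, y} (is3Clique_triple_iff.2 ⟨hxz, hS hyS, hzy⟩)
      have := hout y hyx hyS
      omega
  · have := hout z hzx hzS
    rw [sum_eq_zero fun y _ => by omega]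
    exact Nat.zero_le _

theorem IsAcyclic.span_X_image_mem_ass_partialCoverIdeal_pow (hG : G.IsAcyclic) (ht : 1 ≤ t)
    (hs : 1 ≤ s) {x : V} {S : Finset V} (hS : (S : Set V) ⊆ G.neighborSet x) (hSt : t ≤ #S)
    (hSs : #S ≤ s * (t - 1) + 1) :
    Ideal.span (MvPolynomial.X '' insert x (S : Set V)) ∈ (G.partialCoverIdeal k t ^ s).Ass := by
  classical
  have hx := notMem_of_coe_subset_neighborSet hS
  obtain ⟨u, rfl⟩ : ∃ u, t = u + 1 := ⟨t - 1, by omega⟩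
  obtain ⟨q, rfl⟩ : ∃ q, s = q + 1 := ⟨s - 1, by omega⟩
  simp only [Nat.add_sub_cancel] at hSs
  have hle : (q + 1) * u + 1 ≤ (q + 1) * #S := by nlinarith
  -- This is equivalent to the bound `hSs`. It lets the leaf exponents stay below `s = q + 1`.
  have hm : (q + 1) * #S - ((q + 1) * u + 1) ≤ #S * q := by
    have : (q + 1) * #S = #S * q + #S := by ring
    omega
  obtain ⟨d, hd, hdsum⟩ := S.exists_sum_eq_of_le_card_mul q hm
  -- The witness has weight `s * (#S + 1 - t) - 1`, one short of the star condition, and exponent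
  -- `s` off the star, where it then imposes nothing. Any variable of the star makes up the deficit.
  set a : V →₀ ℕ := Finsupp.equivFunOnFinite.symm
    fun v => if v = x then 0 else if v ∈ S then d v else q + 1 with ha
  have hax : a x = 0 := by simp [ha]
  have haS : ∀ y ∈ S, a y = d y := fun y hy => by
    simp [ha, ne_of_mem_of_not_mem hy hx, hy]
  have haout : ∀ v, v ≠ x → v ∉ S → a v = q + 1 := fun v h1 h2 => by simp [ha, h1, h2]
  have hasum : ∑ y ∈ S, a y + ((q + 1) * u + 1) = (q + 1) * #S := by
    rw [sum_congr rfl haS, hdsum]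
    omega
  have hdiff : ∑ y ∈ S, (q + 1 - d y) = (q + 1) * u + 1 := by
    have : ∑ y ∈ S, (q + 1 - d y) + ∑ y ∈ S, d y = (q + 1) * #S := by
      rw [← sum_add_distrib, mul_comm, ← smul_eq_mul, ← sum_const]
      exact sum_congr rfl fun y _ => by have := hd y; omega
    rw [hdsum] at this
    omega
  refine Submodule.isAssociatedPrime_iff.2 ⟨MvPolynomial.isPrime_span_X_image _,
    MvPolynomial.monomial a 1, le_antisymm ?_ fun g hg => ?_⟩
  · rw [Ideal.span_le]
    rintro _ ⟨v, hv, rfl⟩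
    rw [SetLike.mem_coe, Submodule.mem_colon_singleton, smul_eq_mul, MvPolynomial.X,
      MvPolynomial.monomial_mul, one_mul]
    refine hG.monomial_mem_partialCoverIdeal_pow ht
      (hG.sum_sub_le_of_forall_notMem hS (fun w h1 h2 => ?_) ?_ fun z hz => ?_) _
    · rw [Finsupp.add_apply, haout w h1 h2]
      omega
    · rcases eq_or_ne v x with rfl | hvx
      · have h1 : ∀ y ∈ S, Finsupp.single v 1 y = 0 := fun y hy =>
          Finsupp.single_eq_of_ne (ne_of_mem_of_not_mem hy hx)
        have h2 : ∑ y ∈ S, (q + (q + 1 - d y) - (q + 1)) + #S = ∑ y ∈ S, (q + 1 - d y) := by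
          rw [card_eq_sum_ones, ← sum_add_distrib]
          exact sum_congr rfl fun y _ => by have := hd y; omega
        have h3 : ∑ y ∈ S, (q + 1 - (Finsupp.single v 1 + a : V →₀ ℕ) v +
            (q + 1 - (Finsupp.single v 1 + a : V →₀ ℕ) y) - (q + 1)) =
            ∑ y ∈ S, (q + (q + 1 - d y) - (q + 1)) :=
          sum_congr rfl fun y hy => by
            simp only [Finsupp.add_apply, h1 y hy, haS y hy, hax, Finsupp.single_eq_same]
            omega
        rw [h3]
        simp only [Finsupp.add_apply, hax, Finsupp.single_eq_same]
        rw [hdiff, add_mul, one_mul] at h2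
        rw [Nat.add_sub_cancel, add_zero, Nat.add_sub_cancel, mul_comm u]
        omega
      · have hvS : v ∈ S := hv.resolve_left hvx
        have hbx : (Finsupp.single v 1 + a : V →₀ ℕ) x = 0 := by
          simp [hax, Finsupp.single_eq_of_ne hvx.symm]
        have h2 : ∑ y ∈ S, (q + 1 - (Finsupp.single v 1 + a : V →₀ ℕ) y) <
            ∑ y ∈ S, (q + 1 - d y) := by
          refine sum_lt_sum (fun y hy => ?_) ⟨v, hvS, ?_⟩
          · rw [Finsupp.add_apply, haS y hy]
            omega
          · have := hd v
            rw [Finsupp.add_apply, haS v hvS, Finsupp.single_eq_same]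
            omega
        simp only [hbx, Nat.sub_zero, Nat.add_sub_cancel_left, Nat.add_sub_cancel]
        rw [hdiff, mul_comm (q + 1)] at h2
        omega
    -- For `t = 1` the right side vanishes, but the star is a single edge with exponents 0 and `s -
    -- 1` before the multiplication. For `t > 1` the bound at a leaf is automatic.
    · rcases Nat.eq_zero_or_pos u with rfl | hu
      · obtain ⟨y, rfl⟩ := card_eq_one.1 (by omega : #S = 1)
        obtain rfl := mem_singleton.1 hz
        have hz0 : a z = q := by simpa using hasum
        have hzx : z ≠ x := ne_of_mem_of_not_mem hz hx
        have hvzx : v = x ∨ v = z := by simpa using hv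
        simp only [Finsupp.add_apply, hax, hz0]
        rcases hvzx with rfl | rfl
        · rw [Finsupp.single_eq_same]
          omega
        · rw [Finsupp.single_eq_same]
          omega
      · rw [Nat.add_sub_cancel]
        refine le_trans ?_ (Nat.le_mul_of_pos_left _ hu)
        omega
  · rw [Submodule.mem_colon_singleton, smul_eq_mul] at hg
    have := partialCoverIdeal_pow_le_weightedOrderIdeal hS hg
    rw [MvPolynomial.mem_weightedOrderIdeal, MvPolynomial.coe_mul,
      MvPowerSeries.weightedOrder_mul, MvPolynomial.coe_monomial,
      MvPowerSeries.weightedOrder_monomial_of_ne_zero _ one_ne_zero, weight_starWeight hx, hax] at this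
    rw [← setOf_starWeight_ne_zero hSt, MvPolynomial.mem_span_X_image_iff_one_le_weightedOrder,
      Order.one_le_iff_ne_zero]
    -- If `g` had order 0, the weight of `a` itself would have to reach `s * (#S + 1 - t)`.
    intro h0
    rw [h0, zero_add, Nat.cast_le, mul_zero, zero_add] at this
    obtain ⟨r, hr⟩ : ∃ r, #S = r + u := ⟨#S - u, by omega⟩
    have hr' : #S + 1 - (u + 1) = r := by omega
    rw [hr'] at this
    rw [hr, mul_add] at hasum
    omega

theorem IsAcyclic.mem_ass_partialCoverIdeal_pow_iff (hG : G.IsAcyclic) (ht : 1 ≤ t) (hs : 1 ≤ s)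
    {P : Ideal (MvPolynomial V k)} :
    P ∈ (G.partialCoverIdeal k t ^ s).Ass ↔ ∃ (x : V) (S : Finset V),
      (S : Set V) ⊆ G.neighborSet x ∧ t ≤ #S ∧ #S ≤ s * (t - 1) + 1 ∧
      P = Ideal.span (MvPolynomial.X '' insert x (S : Set V)) := by
  classical
  constructor
  · intro hP
    rw [hG.partialCoverIdeal_pow_eq_inf ht] at hP
    obtain ⟨⟨x, S⟩, hmem, hP⟩ := Ideal.exists_mem_ass_of_mem_ass_finset_inf hP
    obtain ⟨hS, hSt, hSs⟩ := (mem_filter.1 hmem).2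
    refine ⟨x, S, fun y hy => by simpa using hS hy, hSt, hSs, ?_⟩
    rw [← setOf_starWeight_ne_zero hSt]
    exact MvPolynomial.eq_span_X_image_of_mem_ass_weightedOrderIdeal hP
  · rintro ⟨x, S, hS, hSt, hSs, rfl⟩
    exact hG.span_X_image_mem_ass_partialCoverIdeal_pow ht hs hS hSt hSs

theorem IsAcyclic.ass_partialCoverIdeal_pow_mono (hG : G.IsAcyclic) (ht : 1 ≤ t) (hs : 1 ≤ s)
    {s' : ℕ} (h : s ≤ s') :
    (G.partialCoverIdeal k t ^ s).Ass ⊆ (G.partialCoverIdeal k t ^ s').Ass := by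
  intro P hP
  obtain ⟨x, S, hS, hSt, hSs, rfl⟩ := (hG.mem_ass_partialCoverIdeal_pow_iff ht hs).1 hP
  have := Nat.mul_le_mul_right (t - 1) h
  exact (hG.mem_ass_partialCoverIdeal_pow_iff ht (hs.trans h)).2
    ⟨x, S, hS, hSt, by omega, rfl⟩

theorem card_le_maxDegree_of_coe_subset_neighborSet {x : V} {S : Finset V}
    (hS : (S : Set V) ⊆ G.neighborSet x) : #S ≤ G.maxDegree :=
  (card_le_card fun y hy => by simpa using hS hy).trans (G.degree_le_maxDegree x)

theorem IsAcyclic.ass_partialCoverIdeal_pow_subset (hG : G.IsAcyclic) (ht : 1 ≤ t) (hs : 1 ≤ s)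
    {s' : ℕ} (hs' : 1 ≤ s') (h : t = 1 ∨ G.maxDegree ≤ s * (t - 1) + 1) :
    (G.partialCoverIdeal k t ^ s').Ass ⊆ (G.partialCoverIdeal k t ^ s).Ass := by
  intro P hP
  obtain ⟨x, S, hS, hSt, hSs, rfl⟩ := (hG.mem_ass_partialCoverIdeal_pow_iff ht hs').1 hP
  refine (hG.mem_ass_partialCoverIdeal_pow_iff ht hs).2 ⟨x, S, hS, hSt, ?_, rfl⟩
  rcases h with rfl | h
  · simpa using hSs
  · exact (card_le_maxDegree_of_coe_subset_neighborSet hS).trans h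

/-- The prime of the full star at a vertex of maximal degree is the last kind to appear. Another
star could generate the same prime, so numbers of variables are compared. -/
theorem IsAcyclic.maxDegree_le_of_ass_partialCoverIdeal_pow_subset (hG : G.IsAcyclic)
    (ht : 1 ≤ t) (hs : 1 ≤ s) {s' : ℕ} (hs' : 1 ≤ s') (hΔ : G.maxDegree ≤ s' * (t - 1) + 1)
    (h : (G.partialCoverIdeal k t ^ s').Ass ⊆ (G.partialCoverIdeal k t ^ s).Ass) :
    G.maxDegree ≤ s * (t - 1) + 1 := by
  by_contra! hlt
  have : Nonempty V := by
    by_contra hV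
    rw [not_nonempty_iff] at hV
    simp at hlt
  obtain ⟨x, hx⟩ := G.exists_maximal_degree_vertex
  have htΔ : t ≤ G.maxDegree := by
    have := Nat.mul_le_mul_right (t - 1) hs
    omega
  have hmem := h ((hG.mem_ass_partialCoverIdeal_pow_iff ht hs').2
    ⟨x, G.neighborFinset x, by simp, by simpa [← hx] using htΔ, by simpa [← hx] using hΔ, rfl⟩)
  obtain ⟨z, S, hS, -, hSs, heq⟩ := (hG.mem_ass_partialCoverIdeal_pow_iff ht hs).1 hmem
  classical
  have hsub : insert x (G.neighborFinset x) ⊆ insert z S := by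
    intro v hv
    have hv' : (MvPolynomial.X v : MvPolynomial V k) ∈
        Ideal.span (MvPolynomial.X '' insert z (S : Set V)) :=
      heq ▸ Ideal.subset_span ⟨v, by simpa using hv, rfl⟩
    rw [MvPolynomial.mem_ideal_span_X_image] at hv'
    obtain ⟨i, hi, h0⟩ := hv' (Finsupp.single v 1) (by simp [MvPolynomial.support_X])
    obtain rfl : v = i := by
      by_contra hne
      exact h0 (Finsupp.single_eq_of_ne fun h => hne h.symm)
    simpa using hi
  have hcard := card_le_card hsub
  rw [card_insert_of_notMem (by simp), card_insert_of_notMem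
    (notMem_of_coe_subset_neighborSet hS), card_neighborFinset_eq_degree, ← hx] at hcard
  omega

end SimpleGraph

theorem theorem1p2 {k : Type*} [Field k] {V : Type*} [Fintype V]
    (G : SimpleGraph V) [DecidableRel G.Adj] (hG : G.IsAcyclic) (t : ℕ) (ht : 1 ≤ t) :
    (G.partialCoverIdeal k t).HasPersistenceProperty ∧
    (t = 1 → (G.partialCoverIdeal k t).IsIndexOfStability 1) ∧
    (1 < t → ∃ a : ℕ,
      IsLeast {s : ℕ | 1 ≤ s ∧ (s : ℤ) * ((t : ℤ) - 1) ≥ (G.maxDegree : ℤ) - 1} a ∧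
      (G.partialCoverIdeal k t).IsIndexOfStability a) := by
  have hset : {s : ℕ | 1 ≤ s ∧ (s : ℤ) * ((t : ℤ) - 1) ≥ (G.maxDegree : ℤ) - 1} =
      {s : ℕ | 1 ≤ s ∧ G.maxDegree ≤ s * (t - 1) + 1} := by
    ext s
    simp only [Set.mem_ofPred_eq]
    zify [ht]
    exact and_congr_right fun _ => ⟨fun h => by linarith, fun h => by linarith⟩
  rw [hset]
  have hstable : ∀ a, 1 ≤ a → (t = 1 ∨ G.maxDegree ≤ a * (t - 1) + 1) → ∀ s, a ≤ s →
      (G.partialCoverIdeal k t ^ s).Ass = (G.partialCoverIdeal k t ^ a).Ass := fun a ha h s hs =>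
    (hG.ass_partialCoverIdeal_pow_subset ht ha (ha.trans hs) h).antisymm
      (hG.ass_partialCoverIdeal_pow_mono ht ha hs)
  refine ⟨fun s hs => hG.ass_partialCoverIdeal_pow_mono ht hs (Nat.le_succ s), fun h => ?_,
    fun h => ?_⟩
  · exact ⟨⟨le_rfl, hstable 1 le_rfl (Or.inl h)⟩, fun s hs => hs.1⟩
  · have hne : {s : ℕ | 1 ≤ s ∧ G.maxDegree ≤ s * (t - 1) + 1}.Nonempty :=
      ⟨G.maxDegree + 1, Nat.le_add_left _ _,
        (Nat.le_succ _).trans ((Nat.le_mul_of_pos_right _ (by omega)).trans (Nat.le_succ _))⟩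
    have hleast : IsLeast {s : ℕ | 1 ≤ s ∧ G.maxDegree ≤ s * (t - 1) + 1}
        (sInf {s : ℕ | 1 ≤ s ∧ G.maxDegree ≤ s * (t - 1) + 1}) :=
      ⟨Nat.sInf_mem hne, fun s hs => Nat.sInf_le hs⟩
    refine ⟨_, hleast, ⟨hleast.1.1, hstable _ hleast.1.1 (Or.inr hleast.1.2)⟩, fun s hs => ?_⟩
    by_contra! hlt
    exact hlt.not_ge (hleast.2 ⟨hs.1, hG.maxDegree_le_of_ass_partialCoverIdeal_pow_subset ht hs.1
      hleast.1.1 hleast.1.2 (hs.2 _ hlt.le).subset⟩)
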